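/- **Theorem.** An *$n$-iterate* of a binary operation symbol $V$ is a full bracketing of the variables $x_1,\dots,x_{n+1}$ (in this order), in which $V$ is applied $n$ times. There are $S_n=\frac1{n+1}\binom{2n}{n}$ of them. The tableau $A_n\oplus B_n$ has $n+2$ lines: for each $i=1,\dots,n$ the set of $n$-iterates obtained from the $(n-1)$-iterates $J(x_1,\dots,x_n)$ by substituting $V(x_i,x_{i+1})$ for the $i$-th variable and renumbering the variables (these are the lines of $A_n$), and the two sets of $n$-iterates of the form $V(J,x_{n+1})$ and of the form $V(x_1,J)$, with $J$ an $(n-1)$-iterate (the lines of $B_n$). An identity $J=K$ between two $n$-iterates is *formally reducible* (with respect to $A_n\oplus B_n$) if some line of the tableau contains both $J$ and $K$, and *formally irreducible* otherwise. Identities are counted as ordered pairs $(J,K)$, so that there are $S_n^2$ of them; let $I_n$ be the number of the formally reducible ones. 1. The number $S_n^2-I_n$ of formally irreducible identities between two $n$-iterates is, as $n\to\infty$, $$O\Big(\Big|\tfrac{n+2}{n}e^{-n/16}-\tfrac2n\Big|\,S_n^2\Big).$$ 2. The same bound holds for the number of distinct classes of algebras (sets with a binary operation $V$) that are defined by one formally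 irreducible identity between two $n$-iterates of $V$. 3. For every $n\ge 2$, $$I_n=(n+2)\sum_{\nu=0}^{\lfloor n/2\rfloor}(-1)^\nu\frac1{\nu+1}\binom{n-\nu}{\nu}S_{n-\nu-1}^2 .$$ 4. As $n\to\infty$, $I_n\sim\frac{n+2}{n}S_n^2\big(1-e^{-n/16}\big)$, that is, the quotient of the two sides tends to $1$. -/

import Mathlib

open Filter Asymptotics

universe u

namespace MagmaIdentity

/-- An iterate of a binary operation symbol `V`: a full binary tree, whose internal nodes are the
applications of `V` and whose leaves, read from left to right, are the variables
`x₁, x₂, x₃, …`, each occurring once. -/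
abbrev Iterate : Type := BinaryTree Unit

/-- The application `V (J, K)`; the variables of `K` are renumbered to follow those of `J`. -/
abbrev app (J K : Iterate) : Iterate := BinaryTree.node () J K

/-- The `n`-iterates: those in which the operation is applied exactly `n` times. -/
abbrev iterates (n : ℕ) : Finset Iterate := BinaryTree.treesOfNumNodesEq n

/-- The value of an iterate under an operation `V`, when its leaves carry, from left to right,
the values `x k, x (k + 1), …`. -/
def evalFrom {M : Type*} (V : M → M → M) (x : ℕ → M) : Iterate → ℕ → M
  | .nil, k => x k
  | .node _ J K, k => V (evalFrom V x J k) (evalFrom V x K (k + J.numLeaves))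

/-- The operation `V` satisfies the identity `J = K`. -/
def Satisfies {M : Type*} (V : M → M → M) (J K : Iterate) : Prop :=
  ∀ x : ℕ → M, evalFrom V x J 0 = evalFrom V x K 0

/-- Substitution of `V (x, y)` for the `i`-th variable of `J` (counting from `0`), with the
variables renumbered from left to right afterwards. It leaves `J` unchanged if `J` has no
`i`-th variable. -/
def substAt : Iterate → ℕ → Iterate
  | .nil, i => if i = 0 then app .nil .nil else .nil
  | .node _ J K, i =>
      if i < J.numLeaves then app (substAt J i) K else app J (substAt K (i - J.numLeaves))

/-- The `n` lines of the tableau `A_n`. The line with (zero-based) index `i` consists of the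
`n`-iterates obtained from the `(n - 1)`-iterates by substituting `V (x, y)` for the `i`-th
of their `n` variables. -/
def lineA (n : ℕ) (i : Fin n) : Finset Iterate :=
  (iterates (n - 1)).image fun J => substAt J i

/-- The two lines of the tableau `B_n`: the `n`-iterates `V (J, x)` and the `n`-iterates
`V (x, J)`, where `J` is an `(n - 1)`-iterate and `x` a variable. -/
def lineB (n : ℕ) (i : Fin 2) : Finset Iterate :=
  (iterates (n - 1)).image fun J => if i = 0 then app J .nil else app .nil J

/-- The `n + 2` lines of the combined tableau `A_n ⊕ B_n`. -/
def line (n : ℕ) : Fin n ⊕ Fin 2 → Finset Iterate :=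
  Sum.elim (lineA n) (lineB n)

/-- The identity `J = K` between `n`-iterates is formally reducible with respect to
`A_n ⊕ B_n`: some line of the tableau contains both sides. -/
def FormallyReducible (n : ℕ) (J K : Iterate) : Prop :=
  ∃ i : Fin n ⊕ Fin 2, J ∈ line n i ∧ K ∈ line n i

instance (n : ℕ) (J K : Iterate) : Decidable (FormallyReducible n J K) :=
  inferInstanceAs (Decidable (∃ i : Fin n ⊕ Fin 2, J ∈ line n i ∧ K ∈ line n i))

/-- The formally reducible identities `J = K` between two `n`-iterates, as ordered pairs. -/
def reducibleIdentities (n : ℕ) : Finset (Iterate × Iterate) :=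
  (iterates n ×ˢ iterates n).filter fun p => FormallyReducible n p.1 p.2

/-- The formally irreducible identities `J = K` between two `n`-iterates, as ordered pairs. -/
def irreducibleIdentities (n : ℕ) : Finset (Iterate × Iterate) :=
  (iterates n ×ˢ iterates n).filter fun p => ¬ FormallyReducible n p.1 p.2

/-- The class of algebras (sets with a binary operation) defined by the identity
`p.1 = p.2`. -/
def algebrasOf (p : Iterate × Iterate) : Set (Σ M : Type u, M → M → M) :=
  {A | Satisfies A.2 p.1 p.2}

/-- The classes of algebras that are defined by a formally irreducible identity between two
`n`-iterates; identities that are satisfied by the same algebras yield the same class. -/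
def irreducibleAlgebraClasses (n : ℕ) : Set (Set (Σ M : Type u, M → M → M)) :=
  algebrasOf.{u} '' (irreducibleIdentities n : Set (Iterate × Iterate))

end MagmaIdentity

namespace MagmaIdentity

/-! An iterate lies on the `i`-th line of `A_n` iff its leaves `i`, `i + 1` are siblings (a cherry),
and on a line of `B_n` iff the right or the left child of its root is a leaf. Splitting leaf `i` is
a bijection from the `(n - 1)`-iterates onto the `n`-iterates with a cherry at `i`. Contracting
cherries from right to left thus shows that `catalan (n - A.card)` iterates have cherries at all
places of `A` if `A` has no two consecutive elements; otherwise there are none. A leaf under the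
root costs one more node and forbids one extreme place (`card_filter_cherry` and its corollaries).

Inclusion-exclusion over sets `A` of common cherries turns sums over pairs into squares of these
counts. Counting the sparse sets and merging binomials gives the exact formula for `I_n`.

For the asymptotics, let `X` be the number of common cherries of a random pair. Its mean `n S_{n-1}²
/ S_n²` is of order `n / 16`, and its variance is also `O(n)`, because `S_{n-2} S_n` is close to
`S_{n-1}²`. An irreducible pair has `X = 0`, so by Chebyshev there are `O(S_n² / n)` of them. This
suffices: the factor in the stated bound is eventually at least `1 / n`, its exponential term being
negligible, and both sides of part 4 are equivalent to `S_n²`. -/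

/-- The `i`-th and the `(i + 1)`-st leaves of the tree (counting from `0`) are siblings. -/
def Cherry : Iterate → ℕ → Prop
  | .nil, _ => False
  | .node _ J K, i =>
      (J = .nil ∧ K = .nil ∧ i = 0) ∨ Cherry J i ∨ (J.numLeaves ≤ i ∧ Cherry K (i - J.numLeaves))

/-- The right child of the root is a leaf. -/
def RightLeaf (J : Iterate) : Prop := ∃ L, J = app L .nil

/-- The left child of the root is a leaf. -/
def LeftLeaf (J : Iterate) : Prop := ∃ R, J = app .nil R

/-! ### Cherries and leaves at the root under substitution -/

theorem Cherry.lt_numNodes {J : Iterate} {i : ℕ} (h : Cherry J i) : i < J.numNodes := by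
  induction J generalizing i with
  | nil => exact h.elim
  | node a L R hL hR =>
    have := L.numLeaves_eq_numNodes_succ
    rcases h with ⟨-, -, rfl⟩ | h | ⟨hi, h⟩
    · simp [BinaryTree.numNodes]
    · have := hL h
      simp only [BinaryTree.numNodes]; omega
    · have := hR h
      simp only [BinaryTree.numNodes]; omega

/-- Leaf `i + 1` has only one sibling. -/
theorem Cherry.not_succ {J : Iterate} {i : ℕ} (h : Cherry J i) : ¬ Cherry J (i + 1) := by
  induction J generalizing i with
  | nil => exact h.elim
  | node a L R hL hR =>
    have hl := L.numLeaves_eq_numNodes_succ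
    rintro h'
    rcases h with ⟨rfl, rfl, rfl⟩ | h | ⟨hi, h⟩
    · simp [Cherry] at h'
    · have := h.lt_numNodes
      rcases h' with ⟨-, -, h'⟩ | h' | ⟨hi, h'⟩
      · omega
      · exact hL h h'
      · omega
    · rcases h' with ⟨-, -, h'⟩ | h' | ⟨hi', h'⟩
      · omega
      · have := h'.lt_numNodes
        omega
      · rw [show i + 1 - L.numLeaves = i - L.numLeaves + 1 by omega] at h'
        exact hR h h'

theorem numNodes_substAt {J : Iterate} {i : ℕ} (h : i < J.numLeaves) :
    (substAt J i).numNodes = J.numNodes + 1 := by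
  induction J generalizing i with
  | nil =>
    have : i = 0 := by simpa [BinaryTree.numLeaves] using h
    simp [substAt, this, BinaryTree.numNodes]
  | node a L R hL hR =>
    simp only [BinaryTree.numLeaves] at h
    by_cases hi : i < L.numLeaves
    · simp only [substAt, hi, if_true, BinaryTree.numNodes, hL hi]; omega
    · simp only [substAt, hi, if_false, BinaryTree.numNodes,
        hR (show i - L.numLeaves < R.numLeaves by omega)]; omega

theorem substAt_ne_nil {J : Iterate} {i : ℕ} (h : i < J.numLeaves) : substAt J i ≠ .nil := by
  intro h'
  have := numNodes_substAt h
  simp [h', BinaryTree.numNodes] at this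

theorem substAt_injOn (i : ℕ) : Set.InjOn (fun J => substAt J i) {J | i < J.numLeaves} := by
  intro J hJ K hK h
  replace hJ : i < J.numLeaves := hJ
  replace hK : i < K.numLeaves := hK
  replace h : substAt J i = substAt K i := h
  induction J generalizing i K with
  | nil =>
    have h1 := numNodes_substAt hJ
    rw [h, numNodes_substAt hK] at h1
    cases K with
    | nil => rfl
    | node => simp [BinaryTree.numNodes] at h1
  | node a L R hL hR =>
    cases K with
    | nil =>
      have h1 := numNodes_substAt hJ
      rw [h, numNodes_substAt hK] at h1
      simp [BinaryTree.numNodes] at h1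
    | node b L' R' =>
      simp only [BinaryTree.numLeaves] at hJ hK
      have hl := L.numLeaves_eq_numNodes_succ
      have hl' := L'.numLeaves_eq_numNodes_succ
      by_cases h1 : i < L.numLeaves <;> by_cases h2 : i < L'.numLeaves
      · simp only [substAt, h1, h2, if_true, BinaryTree.node.injEq, true_and] at h
        rw [hL i h1 h2 h.1, h.2]
      · simp only [substAt, h1, h2, if_true, if_false, BinaryTree.node.injEq, true_and] at h
        -- Mixed case: `L'` is `L` with a leaf split, so it has more than `i` leaves, against `h2`.
        have := numNodes_substAt h1
        rw [h.1] at this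
        omega
      · simp only [substAt, h1, h2, if_true, if_false, BinaryTree.node.injEq, true_and] at h
        have := numNodes_substAt h2
        rw [← h.1] at this
        omega
      · simp only [substAt, h1, h2, if_false, BinaryTree.node.injEq, true_and] at h
        obtain ⟨rfl, h⟩ := h
        rw [hR (i - L.numLeaves) (by omega) (by omega) h]

theorem cherry_substAt_self {J : Iterate} {i : ℕ} (h : i < J.numLeaves) :
    Cherry (substAt J i) i := by
  induction J generalizing i with
  | nil =>
    have : i = 0 := by simpa [BinaryTree.numLeaves] using h
    simp [substAt, this, Cherry]
  | node a L R hL hR =>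
    simp only [BinaryTree.numLeaves] at h
    by_cases hi : i < L.numLeaves
    · simp only [substAt, hi, if_true]
      exact Or.inr (Or.inl (hL hi))
    · simp only [substAt, hi, if_false]
      exact Or.inr (Or.inr ⟨by omega, hR (by omega)⟩)

theorem Cherry.exists_substAt {K : Iterate} {i : ℕ} (h : Cherry K i) :
    ∃ J : Iterate, i < J.numLeaves ∧ substAt J i = K := by
  induction K generalizing i with
  | nil => exact h.elim
  | node a L R hL hR =>
    rcases h with ⟨rfl, rfl, rfl⟩ | h | ⟨hi, h⟩
    · exact ⟨.nil, by simp [BinaryTree.numLeaves], by simp [substAt]⟩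
    · obtain ⟨J, hJ, rfl⟩ := hL h
      exact ⟨app J R, by simp only [BinaryTree.numLeaves]; omega, by simp [substAt, hJ]⟩
    · obtain ⟨J, hJ, rfl⟩ := hR h
      refine ⟨app L J, by simp only [BinaryTree.numLeaves]; omega, ?_⟩
      simp [substAt, not_lt.2 hi]

/-- Splitting a leaf to the right of leaves `j` and `j + 1` leaves both intact. The case `j + 1 = i`
must be excluded, since splitting leaf `i` destroys a cherry at `j`. -/
theorem cherry_substAt_iff {J : Iterate} {i j : ℕ} (hi : i < J.numLeaves) (hj : j + 1 < i) :
    Cherry (substAt J i) j ↔ Cherry J j := by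
  induction J generalizing i j with
  | nil =>
    simp only [BinaryTree.numLeaves] at hi
    omega
  | node a L R hL hR =>
    simp only [BinaryTree.numLeaves] at hi
    by_cases h : i < L.numLeaves
    · have h1 : ¬ ((substAt L i).numLeaves ≤ j) := by
        rw [BinaryTree.numLeaves_eq_numNodes_succ, numNodes_substAt h]
        have := L.numLeaves_eq_numNodes_succ
        omega
      have h2 : ¬ (L.numLeaves ≤ j) := by omega
      have h3 : L ≠ .nil := by
        rintro rfl
        simp only [BinaryTree.numLeaves] at h
        omega
      simp [substAt, h, Cherry, hL h hj, substAt_ne_nil h, h1, h2, h3]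
    · have h0 : i - L.numLeaves < R.numLeaves := by omega
      simp only [substAt, h, if_false, Cherry, substAt_ne_nil h0, false_and, and_false, false_or]
      by_cases hj' : j + 1 < L.numLeaves
      · have h1 : ¬ (L.numLeaves ≤ j) := by omega
        have h3 : L ≠ .nil := by
          rintro rfl
          simp [BinaryTree.numLeaves] at hj'
        simp [h1, h3]
      by_cases hj1 : j + 1 = L.numLeaves
      · have h1 : ¬ (L.numLeaves ≤ j) := by omega
        have h4 : ¬ (L = .nil ∧ R = .nil ∧ j = 0) := by
          rintro ⟨rfl, rfl, rfl⟩
          simp only [BinaryTree.numLeaves] at *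
          omega
        simp [h1, h4]
      · have h5 : j - L.numLeaves + 1 < i - L.numLeaves := by omega
        have h4 : ¬ (L = .nil ∧ R = .nil ∧ j = 0) := by
          rintro ⟨rfl, rfl, rfl⟩
          simp only [BinaryTree.numLeaves] at *
          omega
        rw [hR h0 h5]
        simp [h4]

theorem rightLeaf_substAt_iff {J : Iterate} {i : ℕ} (hi : i + 1 < J.numLeaves) :
    RightLeaf (substAt J i) ↔ RightLeaf J := by
  cases J with
  | nil => simp [BinaryTree.numLeaves] at hi
  | node a L R =>
    simp only [BinaryTree.numLeaves] at hi
    by_cases h : i < L.numLeaves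
    · simp [substAt, h, RightLeaf]
    · have h0 : i - L.numLeaves < R.numLeaves := by omega
      have : R ≠ .nil := by
        rintro rfl
        simp only [BinaryTree.numLeaves] at hi
        omega
      simp [substAt, h, RightLeaf, substAt_ne_nil h0, this]

theorem leftLeaf_substAt_iff {J : Iterate} {i : ℕ} (h0 : i ≠ 0) (hi : i < J.numLeaves) :
    LeftLeaf (substAt J i) ↔ LeftLeaf J := by
  cases J with
  | nil =>
    simp only [BinaryTree.numLeaves] at hi
    omega
  | node a L R =>
    simp only [BinaryTree.numLeaves] at hi
    by_cases h : i < L.numLeaves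
    · have : L ≠ .nil := by
        rintro rfl
        simp only [BinaryTree.numLeaves] at h
        omega
      simp [substAt, h, LeftLeaf, substAt_ne_nil h, this]
    · simp [substAt, h, LeftLeaf]

theorem RightLeaf.not_cherry {J : Iterate} {i : ℕ} (h : RightLeaf J) (hi : i + 1 = J.numNodes)
    (h2 : 2 ≤ J.numNodes) : ¬ Cherry J i := by
  obtain ⟨L, rfl⟩ := h
  simp only [BinaryTree.numNodes] at hi h2
  rintro (⟨rfl, -, rfl⟩ | h | ⟨-, h⟩)
  · simp [BinaryTree.numNodes] at h2
  · have := h.lt_numNodes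
    omega
  · exact h

theorem LeftLeaf.not_cherry_zero {J : Iterate} (h : LeftLeaf J) (h2 : 2 ≤ J.numNodes) :
    ¬ Cherry J 0 := by
  obtain ⟨R, rfl⟩ := h
  simp only [BinaryTree.numNodes] at h2
  rintro (⟨-, rfl, -⟩ | h | ⟨hi, -⟩)
  · simp [BinaryTree.numNodes] at h2
  · exact h
  · simp [BinaryTree.numLeaves] at hi

theorem LeftLeaf.not_rightLeaf {J : Iterate} (h : LeftLeaf J) (h2 : 2 ≤ J.numNodes) :
    ¬ RightLeaf J := by
  obtain ⟨R, rfl⟩ := h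
  rintro ⟨L, h⟩
  simp only [BinaryTree.node.injEq, true_and] at h
  obtain ⟨-, rfl⟩ := h
  simp [BinaryTree.numNodes] at h2

/-! ### The lines of the tableau in terms of cherries and root leaves -/

theorem mem_lineA_iff {n : ℕ} (i : Fin n) (J : Iterate) :
    J ∈ lineA n i ↔ J.numNodes = n ∧ Cherry J i := by
  have hi := i.2
  simp only [lineA, Finset.mem_image, BinaryTree.mem_treesOfNumNodesEq]
  constructor
  · rintro ⟨K, hK, rfl⟩
    have h : (i : ℕ) < K.numLeaves := by rw [K.numLeaves_eq_numNodes_succ]; omega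
    exact ⟨by rw [numNodes_substAt h]; omega, cherry_substAt_self h⟩
  · rintro ⟨h, hc⟩
    obtain ⟨K, hK, rfl⟩ := hc.exists_substAt
    rw [numNodes_substAt hK] at h
    exact ⟨K, by omega, rfl⟩

theorem mem_lineB_zero_iff {n : ℕ} (hn : n ≠ 0) (J : Iterate) :
    J ∈ lineB n 0 ↔ J.numNodes = n ∧ RightLeaf J := by
  simp only [lineB, Finset.mem_image, BinaryTree.mem_treesOfNumNodesEq, if_true]
  constructor
  · rintro ⟨K, hK, rfl⟩
    exact ⟨by simp only [BinaryTree.numNodes]; omega, K, rfl⟩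
  · rintro ⟨h, K, rfl⟩
    simp only [BinaryTree.numNodes] at h
    exact ⟨K, by omega, rfl⟩

theorem mem_lineB_one_iff {n : ℕ} (hn : n ≠ 0) (J : Iterate) :
    J ∈ lineB n 1 ↔ J.numNodes = n ∧ LeftLeaf J := by
  simp only [lineB, Finset.mem_image, BinaryTree.mem_treesOfNumNodesEq, one_ne_zero, if_false]
  constructor
  · rintro ⟨K, hK, rfl⟩
    exact ⟨by simp only [BinaryTree.numNodes]; omega, K, rfl⟩
  · rintro ⟨h, K, rfl⟩
    simp only [BinaryTree.numNodes] at h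
    exact ⟨K, by omega, rfl⟩

/-! ### Counting iterates with prescribed cherries -/

open Classical in
-- Induction on the largest place: contracting that cherry removes one node and disturbs neither the
-- cherries further left, which are at distance at least 2, nor `P`. The margin `c` keeps `A` away
-- from the last leaves when splitting these could change `P`: it is 1 for `RightLeaf` and 0
-- otherwise.
theorem card_filter_cherry (P : Iterate → Prop) (c n : ℕ) (A : Finset ℕ) (hA : A ⊆ Finset.range (n - c))
    (hs : ∀ i ∈ A, i + 1 ∉ A)
    (hP : ∀ i ∈ A, ∀ J : Iterate, i + c < J.numLeaves → (P (substAt J i) ↔ P J)) :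
    ((iterates n).filter fun J => (∀ i ∈ A, Cherry J i) ∧ P J).card =
      ((iterates (n - A.card)).filter P).card := by
  induction A using Finset.induction_on_max generalizing n with
  | empty => simp
  | insert a s ha ih =>
    have han := Finset.mem_range.1 (hA (Finset.mem_insert_self a s))
    have has : a ∉ s := fun h => (ha a h).false
    have hgap : ∀ x ∈ s, x + 1 < a := by
      intro x hx
      have h1 := ha x hx
      have h2 := hs x (Finset.mem_insert_of_mem hx)
      have : x + 1 ≠ a := fun h => h2 (h ▸ Finset.mem_insert_self _ _)
      omega
    rw [Finset.card_insert_of_notMem has, show n - (s.card + 1) = n - 1 - s.card by omega,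
      ← ih (n - 1) (fun x hx => by have := hgap x hx; simp; omega)
        (fun i hi h => hs i (Finset.mem_insert_of_mem hi) (Finset.mem_insert_of_mem h))
        (fun i hi => hP i (Finset.mem_insert_of_mem hi))]
    symm
    refine Finset.card_bij (fun J _ => substAt J a) ?_ ?_ ?_
    · intro J hJ
      simp only [Finset.mem_filter, BinaryTree.mem_treesOfNumNodesEq] at hJ ⊢
      obtain ⟨hn, hc, hp⟩ := hJ
      have hl := J.numLeaves_eq_numNodes_succ
      have hJa : a < J.numLeaves := by omega
      refine ⟨by rw [numNodes_substAt hJa]; omega, fun i hi => ?_,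
        (hP a (Finset.mem_insert_self _ _) J (by omega)).2 hp⟩
      rcases Finset.mem_insert.1 hi with rfl | hi
      · exact cherry_substAt_self hJa
      · exact (cherry_substAt_iff hJa (hgap i hi)).2 (hc i hi)
    · intro J hJ K hK h
      simp only [Finset.mem_filter, BinaryTree.mem_treesOfNumNodesEq] at hJ hK
      have hl := J.numLeaves_eq_numNodes_succ
      have hl' := K.numLeaves_eq_numNodes_succ
      exact substAt_injOn a (show a < J.numLeaves by omega) (show a < K.numLeaves by omega) h
    · intro K hK
      simp only [Finset.mem_filter, BinaryTree.mem_treesOfNumNodesEq] at hK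
      obtain ⟨hn, hc, hp⟩ := hK
      obtain ⟨J, hJ, rfl⟩ := (hc a (Finset.mem_insert_self _ _)).exists_substAt
      have hl := J.numLeaves_eq_numNodes_succ
      rw [numNodes_substAt hJ] at hn
      refine ⟨J, ?_, rfl⟩
      simp only [Finset.mem_filter, BinaryTree.mem_treesOfNumNodesEq]
      exact ⟨by omega, fun i hi => (cherry_substAt_iff hJ (hgap i hi)).1
        (hc i (Finset.mem_insert_of_mem hi)),
        (hP a (Finset.mem_insert_self _ _) J (by omega)).1 hp⟩

open Classical in
theorem card_filter_rightLeaf {n : ℕ} (hn : n ≠ 0) :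
    ((iterates n).filter RightLeaf).card = catalan (n - 1) := by
  rw [← BinaryTree.treesOfNumNodesEq_card_eq_catalan,
    ← Finset.card_image_of_injective (iterates (n - 1)) (f := fun J : Iterate => app J .nil)
      (fun J K h => by simpa using h)]
  congr 1
  ext J
  have := mem_lineB_zero_iff hn J
  simpa [lineB] using this.symm

open Classical in
theorem card_filter_leftLeaf {n : ℕ} (hn : n ≠ 0) :
    ((iterates n).filter LeftLeaf).card = catalan (n - 1) := by
  rw [← BinaryTree.treesOfNumNodesEq_card_eq_catalan,
    ← Finset.card_image_of_injective (iterates (n - 1)) (f := fun J : Iterate => app .nil J)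
      (fun J K h => by simpa using h)]
  congr 1
  ext J
  have := mem_lineB_one_iff hn J
  simpa [lineB] using this.symm

open Classical in
theorem card_cherries {n : ℕ} {A : Finset ℕ} (hA : A ⊆ Finset.range n) :
    ((iterates n).filter fun J => ∀ i ∈ A, Cherry J i).card =
      if ∀ i ∈ A, i + 1 ∉ A then catalan (n - A.card) else 0 := by
  split_ifs with hs
  · have := card_filter_cherry (fun _ => True) 0 n A hA hs (by simp)
    simpa [BinaryTree.treesOfNumNodesEq_card_eq_catalan] using this
  · push Not at hs
    obtain ⟨i, hi, hi'⟩ := hs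
    rw [Finset.card_eq_zero, Finset.filter_eq_empty_iff]
    exact fun J _ h => (h i hi).not_succ (h _ hi')

open Classical in
theorem card_cherries_rightLeaf {n : ℕ} (hn : 2 ≤ n) {A : Finset ℕ} (hA : A ⊆ Finset.range n) :
    ((iterates n).filter fun J => (∀ i ∈ A, Cherry J i) ∧ RightLeaf J).card =
      if A ⊆ Finset.range (n - 1) ∧ ∀ i ∈ A, i + 1 ∉ A then catalan (n - 1 - A.card) else 0 := by
  split_ifs with hs
  · have hc := Finset.card_le_card hs.1
    rw [Finset.card_range] at hc
    rw [card_filter_cherry RightLeaf 1 n A hs.1 hs.2 (fun i _ J h => rightLeaf_substAt_iff h),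
      card_filter_rightLeaf (by omega)]
    congr 1
    omega
  · rw [Finset.card_eq_zero, Finset.filter_eq_empty_iff]
    rintro J hJ ⟨hc, hr⟩
    rw [BinaryTree.mem_treesOfNumNodesEq] at hJ
    refine hs ⟨fun i hi => ?_, fun i hi hi' => (hc i hi).not_succ (hc _ hi')⟩
    have h1 := Finset.mem_range.1 (hA hi)
    have h2 : i + 1 ≠ n := fun h => hr.not_cherry (hJ ▸ h) (hJ ▸ hn) (hc i hi)
    rw [Finset.mem_range]
    omega

open Classical in
theorem card_cherries_leftLeaf {n : ℕ} (hn : 2 ≤ n) {A : Finset ℕ} (hA : A ⊆ Finset.range n) :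
    ((iterates n).filter fun J => (∀ i ∈ A, Cherry J i) ∧ LeftLeaf J).card =
      if A ⊆ Finset.Ico 1 n ∧ ∀ i ∈ A, i + 1 ∉ A then catalan (n - 1 - A.card) else 0 := by
  split_ifs with hs
  · have hc := Finset.card_le_card hs.1
    rw [Nat.card_Ico] at hc
    rw [card_filter_cherry LeftLeaf 0 n A hA hs.2
      (fun i hi J h => leftLeaf_substAt_iff (by have := Finset.mem_Ico.1 (hs.1 hi); omega) h),
      card_filter_leftLeaf (by omega)]
    congr 1
    omega
  · rw [Finset.card_eq_zero, Finset.filter_eq_empty_iff]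
    rintro J hJ ⟨hc, hr⟩
    rw [BinaryTree.mem_treesOfNumNodesEq] at hJ
    refine hs ⟨fun i hi => ?_, fun i hi hi' => (hc i hi).not_succ (hc _ hi')⟩
    have h1 := Finset.mem_range.1 (hA hi)
    have h2 : i ≠ 0 := fun h => hr.not_cherry_zero (hJ ▸ hn) (h ▸ hc i hi)
    rw [Finset.mem_Ico]
    omega

/-! ### Sums over sets without consecutive elements -/

/-- Split by whether the last element `a + (n + 1)` belongs to the set; if it does, `a + n` does
not, and removing the last element leaves a sparse subset of the shorter interval. -/
theorem sum_powerset_sparse_succ_succ (f : ℕ → ℝ) (a n : ℕ) :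
    (∑ A ∈ (Finset.Ico a (a + (n + 2))).powerset, if ∀ i ∈ A, i + 1 ∉ A then f A.card else 0) =
      (∑ A ∈ (Finset.Ico a (a + (n + 1))).powerset, if ∀ i ∈ A, i + 1 ∉ A then f A.card else 0) +
      ∑ A ∈ (Finset.Ico a (a + n)).powerset,
        if ∀ i ∈ A, i + 1 ∉ A then f (A.card + 1) else 0 := by
  have h1 : Finset.Ico a (a + (n + 2)) = insert (a + (n + 1)) (Finset.Ico a (a + (n + 1))) := by
    ext; simp; omega
  have h2 : Finset.Ico a (a + (n + 1)) = insert (a + n) (Finset.Ico a (a + n)) := by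
    ext; simp; omega
  rw [h1, Finset.sum_powerset_insert (by simp)]
  congr 1
  rw [h2, Finset.sum_powerset_insert (by simp)]
  rw [← add_zero (∑ A ∈ (Finset.Ico a (a + n)).powerset,
        if ∀ i ∈ A, i + 1 ∉ A then f (A.card + 1) else 0)]
  congr 1
  · refine Finset.sum_congr rfl fun A hA => ?_
    rw [Finset.mem_powerset] at hA
    have hlt : ∀ i ∈ A, i < a + n := fun i hi => (Finset.mem_Ico.1 (hA hi)).2
    have hn : a + (n + 1) ∉ A := fun h => by have := hlt _ h; omega
    rw [Finset.card_insert_of_notMem hn]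
    congr 1
    refine propext ⟨fun h i hi hi' => ?_, fun h i hi hi' => ?_⟩
    · exact h i (Finset.mem_insert_of_mem hi) (Finset.mem_insert_of_mem hi')
    · rw [Finset.mem_insert] at hi hi'
      rcases hi with rfl | hi
      · rcases hi' with h' | h'
        · omega
        · have := hlt _ h'; omega
      · rcases hi' with h' | h'
        · have := hlt _ hi; omega
        · exact h i hi h'
  · refine Finset.sum_eq_zero fun A _ => if_neg fun h => ?_
    exact h (a + n) (by simp) (by simp [add_assoc])

/-- A set of `n` consecutive natural numbers has `(n + 1 - k).choose k` subsets of cardinality `k`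
without consecutive elements. -/
theorem sum_powerset_sparse (f : ℕ → ℝ) (a n : ℕ) :
    (∑ A ∈ (Finset.Ico a (a + n)).powerset, if ∀ i ∈ A, i + 1 ∉ A then f A.card else 0) =
      ∑ k ∈ Finset.range (n + 1), ((n + 1 - k).choose k : ℝ) * f k := by
  induction n using Nat.twoStepInduction generalizing f with
  | zero => simp
  | one =>
    have : (Finset.Ico a (a + 1)).powerset = {∅, {a}} := by simp; rfl
    rw [this, Finset.sum_pair (by simp)]
    simp [Finset.sum_range_succ]
  | more n h1 h2 =>
    rw [sum_powerset_sparse_succ_succ, h2 f, h1 fun k => f (k + 1), Finset.sum_range_succ',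
      Finset.sum_range_succ' (fun k => ((n + 2 + 1 - k).choose k : ℝ) * f k),
      Finset.sum_range_succ (fun k => ((n + 2 + 1 - (k + 1)).choose (k + 1) : ℝ) * f (k + 1)),
      add_right_comm, ← Finset.sum_add_distrib]
    congr 1
    · rw [show n + 2 + 1 - (n + 1 + 1) = 1 by omega, Nat.choose_eq_zero_of_lt (by omega)]
      simp only [Nat.cast_zero, zero_mul, add_zero]
      refine Finset.sum_congr rfl fun k hk => ?_
      rw [Finset.mem_range] at hk
      rw [← add_mul, show n + 2 + 1 - (k + 1) = (n + 1 - k) + 1 by omega, Nat.choose_succ_succ,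
        show n + 1 + 1 - (k + 1) = n + 1 - k by omega]
      push_cast
      ring

/-! ### Inclusion-exclusion and the exact formula -/

open Classical in
/-- The indicator function of a predicate on iterates. -/
noncomputable def indic (P : Iterate → Prop) (J : Iterate) : ℝ := if P J then 1 else 0

theorem sum_indic (n : ℕ) (P : Iterate → Prop) [DecidablePred P] :
    ∑ J ∈ iterates n, indic P J = ((iterates n).filter P).card := by
  rw [Finset.card_filter]
  push_cast
  refine Finset.sum_congr rfl fun J _ => ?_
  by_cases h : P J <;> simp [indic, h]

theorem indic_and (P Q : Iterate → Prop) (J : Iterate) :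
    indic (fun J => P J ∧ Q J) J = indic P J * indic Q J := by
  by_cases h : P J <;> by_cases h' : Q J <;> simp [indic, h, h']

open Classical in
theorem prod_indic (P : ℕ → Iterate → Prop) (A : Finset ℕ) (J : Iterate) :
    ∏ i ∈ A, indic (P i) J = indic (fun J => ∀ i ∈ A, P i J) J := by
  simp only [indic]
  rw [Finset.prod_boole]
  congr

theorem sum_sum_indic_mul (n : ℕ) (P : Iterate → Prop) :
    ∑ p ∈ iterates n ×ˢ iterates n, indic P p.1 * indic P p.2 =
      (∑ J ∈ iterates n, indic P J) ^ 2 := by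
  rw [Finset.sum_product, sq, Finset.sum_mul_sum]

theorem formallyReducible_iff {n : ℕ} (hn : n ≠ 0) {J K : Iterate} (hJ : J.numNodes = n)
    (hK : K.numNodes = n) :
    FormallyReducible n J K ↔ (∃ i < n, Cherry J i ∧ Cherry K i) ∨ (RightLeaf J ∧ RightLeaf K) ∨
      (LeftLeaf J ∧ LeftLeaf K) := by
  have h2 : ∀ i : Fin 2, i = 0 ∨ i = 1 := by decide
  constructor
  · rintro ⟨i | i, h⟩
    · simp only [line, Sum.elim_inl, mem_lineA_iff] at h
      exact Or.inl ⟨i, i.2, h.1.2, h.2.2⟩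
    · rcases h2 i with rfl | rfl
      · simp only [line, Sum.elim_inr, mem_lineB_zero_iff hn] at h
        exact Or.inr (Or.inl ⟨h.1.2, h.2.2⟩)
      · simp only [line, Sum.elim_inr, mem_lineB_one_iff hn] at h
        exact Or.inr (Or.inr ⟨h.1.2, h.2.2⟩)
  · rintro (⟨i, hi, h⟩ | h | h)
    · exact ⟨.inl ⟨i, hi⟩, (mem_lineA_iff _ _).2 ⟨hJ, h.1⟩, (mem_lineA_iff _ _).2 ⟨hK, h.2⟩⟩
    · exact ⟨.inr 0, (mem_lineB_zero_iff hn _).2 ⟨hJ, h.1⟩, (mem_lineB_zero_iff hn _).2 ⟨hK, h.2⟩⟩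
    · exact ⟨.inr 1, (mem_lineB_one_iff hn _).2 ⟨hJ, h.1⟩, (mem_lineB_one_iff hn _).2 ⟨hK, h.2⟩⟩

/-- The last factor needs no product term for the two lines of `B_n`: they are disjoint once `n ≥
2`. -/
theorem ite_not_formallyReducible {n : ℕ} (hn : 2 ≤ n) {J K : Iterate} (hJ : J.numNodes = n)
    (hK : K.numNodes = n) :
    (if ¬ FormallyReducible n J K then (1 : ℝ) else 0) =
      (∏ i ∈ Finset.range n, (1 - indic (Cherry · i) J * indic (Cherry · i) K)) *
        (1 - indic RightLeaf J * indic RightLeaf K - indic LeftLeaf J * indic LeftLeaf K) := by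
  have hf := formallyReducible_iff (show n ≠ 0 by omega) hJ hK
  have hlr : LeftLeaf J → ¬ RightLeaf J := fun h => h.not_rightLeaf (hJ ▸ hn)
  by_cases h : ∃ i < n, Cherry J i ∧ Cherry K i
  · obtain ⟨i, hi, hJi, hKi⟩ := h
    rw [Finset.prod_eq_zero (Finset.mem_range.2 hi) (by simp [indic, hJi, hKi]), zero_mul,
      if_neg (not_not.2 (hf.2 (Or.inl ⟨i, hi, hJi, hKi⟩)))]
  · rw [Finset.prod_eq_one, one_mul]
    · rw [or_iff_right h] at hf
      by_cases h1 : RightLeaf J <;> by_cases h2 : LeftLeaf J <;> by_cases h3 : RightLeaf K <;>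
        by_cases h4 : LeftLeaf K <;>
        simp only [h1, h2, h3, h4, and_true, and_false, or_true, or_false, iff_true,
          iff_false] at hf <;> simp [h1, h2, h3, h4, hf, indic]
      all_goals exact hlr h2 h1
    · intro i hi
      rw [Finset.mem_range] at hi
      have : ¬ (Cherry J i ∧ Cherry K i) := fun h' => h ⟨i, hi, h'⟩
      rw [sub_eq_self]
      by_cases h1 : Cherry J i
      · have h2 : ¬ Cherry K i := fun h2 => this ⟨h1, h2⟩
        simp [indic, h2]
      · simp [indic, h1]

/-- Expand the product of `ite_not_formallyReducible` over subsets `A`. Each term is a function of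
`J` times the same function of `K`, so its sum over pairs is a square. -/
theorem card_irreducibleIdentities_eq_sum_powerset {n : ℕ} (hn : 2 ≤ n) :
    ((irreducibleIdentities n).card : ℝ) = ∑ A ∈ (Finset.range n).powerset, (-1) ^ A.card *
      ((∑ J ∈ iterates n, indic (fun J => ∀ i ∈ A, Cherry J i) J) ^ 2 -
        (∑ J ∈ iterates n, indic (fun J => (∀ i ∈ A, Cherry J i) ∧ RightLeaf J) J) ^ 2 -
        (∑ J ∈ iterates n, indic (fun J => (∀ i ∈ A, Cherry J i) ∧ LeftLeaf J) J) ^ 2) := by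
  simp only [← sum_sum_indic_mul, ← Finset.sum_sub_distrib, Finset.mul_sum]
  rw [Finset.sum_comm, irreducibleIdentities, Finset.card_filter, Nat.cast_sum]
  refine Finset.sum_congr rfl fun p hp => ?_
  simp only [Finset.mem_product, BinaryTree.mem_treesOfNumNodesEq] at hp
  push_cast
  rw [ite_not_formallyReducible hn hp.1 hp.2]
  simp only [sub_eq_add_neg (1 : ℝ) (indic _ _ * indic _ _)]
  rw [Finset.prod_one_add, Finset.sum_mul]
  refine Finset.sum_congr rfl fun A _ => ?_
  rw [Finset.prod_neg, Finset.prod_mul_distrib, prod_indic, prod_indic, indic_and, indic_and,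
    indic_and, indic_and]
  ring

open Classical in
theorem card_irreducibleIdentities {n : ℕ} (hn : 2 ≤ n) :
    ((irreducibleIdentities n).card : ℝ) =
      (∑ k ∈ Finset.range (n + 1),
        ((n + 1 - k).choose k : ℝ) * ((-1) ^ k * (catalan (n - k) : ℝ) ^ 2)) -
      2 * ∑ k ∈ Finset.range n,
        ((n - k).choose k : ℝ) * ((-1) ^ k * (catalan (n - 1 - k) : ℝ) ^ 2) := by
  have hr : Finset.range (n - 1) ⊆ Finset.range n := Finset.range_subset_range.2 (by omega)
  have hl : Finset.Ico 1 n ⊆ Finset.range n := fun i hi => by simp at hi ⊢; omega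
  have e0 := sum_powerset_sparse (fun k => (-1) ^ k * (catalan (n - k) : ℝ) ^ 2) 0 n
  have e1 := sum_powerset_sparse (fun k => (-1) ^ k * (catalan (n - 1 - k) : ℝ) ^ 2) 0 (n - 1)
  have e2 := sum_powerset_sparse (fun k => (-1) ^ k * (catalan (n - 1 - k) : ℝ) ^ 2) 1 (n - 1)
  rw [show n - 1 + 1 = n by omega] at e1 e2
  rw [show 1 + (n - 1) = n by omega] at e2
  rw [zero_add, ← Finset.range_eq_Ico] at e0 e1
  -- Brings the sums over subsets of `B` to the common index set of all subsets of `range n`;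
  -- subsets not inside `B` contribute zero.
  have key : ∀ B ⊆ Finset.range n, (∑ A ∈ B.powerset, if ∀ i ∈ A, i + 1 ∉ A then
      (-1) ^ A.card * (catalan (n - 1 - A.card) : ℝ) ^ 2 else 0) =
      ∑ A ∈ (Finset.range n).powerset, (-1) ^ A.card *
        ((if A ⊆ B ∧ ∀ i ∈ A, i + 1 ∉ A then catalan (n - 1 - A.card) else 0 : ℕ) : ℝ) ^ 2 := by
    intro B hB
    refine Finset.sum_subset_zero_on_sdiff (Finset.powerset_mono.2 hB) ?_ ?_
    · intro A hA
      have : ¬ A ⊆ B := by simpa using (Finset.mem_sdiff.1 hA).2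
      simp [this]
    · intro A hA
      rw [Finset.mem_powerset] at hA
      by_cases h : ∀ i ∈ A, i + 1 ∉ A <;> simp only [hA, h, true_and] <;> simp
  rw [two_mul, ← sub_sub, ← e0]
  nth_rewrite 1 [← e1]
  rw [← e2, key _ hr, key _ hl, card_irreducibleIdentities_eq_sum_powerset hn,
    ← Finset.sum_sub_distrib, ← Finset.sum_sub_distrib]
  refine Finset.sum_congr rfl fun A hA => ?_
  rw [Finset.mem_powerset] at hA
  rw [sum_indic, sum_indic, sum_indic, card_cherries hA, card_cherries_rightLeaf hn hA,
    card_cherries_leftLeaf hn hA]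
  by_cases h : ∀ i ∈ A, i + 1 ∉ A
  · rw [if_pos h, if_pos h]
    ring
  · rw [if_neg h, if_neg h, if_neg fun h' => h h'.2, if_neg fun h' => h h'.2]
    simp

theorem card_reducibleIdentities_add (n : ℕ) :
    ((reducibleIdentities n).card : ℝ) + (irreducibleIdentities n).card = (catalan n : ℝ) ^ 2 := by
  have := Finset.card_filter_add_card_filter_not (s := iterates n ×ˢ iterates n)
    (fun p => FormallyReducible n p.1 p.2)
  rw [Finset.card_product, BinaryTree.treesOfNumNodesEq_card_eq_catalan, ← sq] at this
  exact_mod_cast this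

/-- From `(k + 1) C(m, k + 1) = (m - k) C(m, k)` with `m = n - k`, as `(n - 2k) + 2(k + 1) = n + 2`.
This merges the contributions of `A_n` and `B_n`. -/
theorem choose_succ_add_two_mul_choose {n k : ℕ} (hk : k < n) :
    ((n - k).choose (k + 1) : ℝ) + 2 * ((n - k).choose k : ℝ) =
      ((n : ℝ) + 2) * (1 / ((k : ℝ) + 1)) * ((n - k).choose k : ℝ) := by
  have h := Nat.choose_succ_right_eq (n - k) k
  have hk1 : (k : ℝ) + 1 ≠ 0 := by positivity
  have h' : ((n - k).choose (k + 1) : ℝ) * (k + 1) = (n - k).choose k * ((n : ℝ) - 2 * k) := by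
    -- For `2k > n` the natural subtraction truncates, but both binomials vanish.
    rcases le_or_gt k (n - k) with h0 | h0
    · have e : ((n - k - k : ℕ) : ℝ) = (n : ℝ) - 2 * k := by
        rw [Nat.cast_sub h0, Nat.cast_sub hk.le]; ring
      rw [← e]
      exact_mod_cast h
    · rw [Nat.choose_eq_zero_of_lt h0, Nat.choose_eq_zero_of_lt (by omega)]
      simp
  field_simp
  linear_combination h'

theorem card_reducibleIdentities {n : ℕ} (hn : 2 ≤ n) :
    ((reducibleIdentities n).card : ℝ) =
      ((n : ℝ) + 2) * ∑ ν ∈ Finset.range (n / 2 + 1),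
        (-1 : ℝ) ^ ν * (1 / ((ν : ℝ) + 1)) * ((n - ν).choose ν : ℝ) *
          (catalan (n - ν - 1) : ℝ) ^ 2 := by
  have h1 := card_reducibleIdentities_add n
  have h2 := card_irreducibleIdentities hn
  -- Isolates the term `k = 0`, which is `S_n²` and cancels against the total count.
  rw [Finset.sum_range_succ'] at h2
  have h3 : ∑ ν ∈ Finset.range (n / 2 + 1),
        (-1 : ℝ) ^ ν * (1 / ((ν : ℝ) + 1)) * ((n - ν).choose ν : ℝ) *
          (catalan (n - ν - 1) : ℝ) ^ 2 = ∑ ν ∈ Finset.range n,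
        (-1 : ℝ) ^ ν * (1 / ((ν : ℝ) + 1)) * ((n - ν).choose ν : ℝ) *
          (catalan (n - ν - 1) : ℝ) ^ 2 := by
    refine Finset.sum_subset (Finset.range_subset_range.2 (by omega)) fun ν _ hν => ?_
    rw [Finset.mem_range] at hν
    rw [Nat.choose_eq_zero_of_lt (by omega)]
    simp
  have h4 : ((n : ℝ) + 2) * ∑ ν ∈ Finset.range n,
        (-1 : ℝ) ^ ν * (1 / ((ν : ℝ) + 1)) * ((n - ν).choose ν : ℝ) *
          (catalan (n - ν - 1) : ℝ) ^ 2 =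
      -(∑ k ∈ Finset.range n, ((n + 1 - (k + 1)).choose (k + 1) : ℝ) *
        ((-1) ^ (k + 1) * (catalan (n - (k + 1)) : ℝ) ^ 2)) +
      2 * ∑ k ∈ Finset.range n,
        ((n - k).choose k : ℝ) * ((-1) ^ k * (catalan (n - 1 - k) : ℝ) ^ 2) := by
    rw [Finset.mul_sum, Finset.mul_sum, ← Finset.sum_neg_distrib, ← Finset.sum_add_distrib]
    refine Finset.sum_congr rfl fun k hk => ?_
    rw [Nat.add_sub_add_right, show n - 1 - k = n - k - 1 by omega,
      show n - (k + 1) = n - k - 1 by omega]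
    linear_combination (-(-1) ^ k * (catalan (n - k - 1) : ℝ) ^ 2) *
      choose_succ_add_two_mul_choose (Finset.mem_range.1 hk)
  rw [h3, h4]
  simp only [Nat.choose_zero_right, Nat.cast_one, pow_zero, one_mul, Nat.sub_zero] at h2
  linarith

/-! ### Second moment bound for the irreducible identities -/

theorem catalan_succ_mul (n : ℕ) :
    ((n : ℝ) + 2) * catalan (n + 1) = 2 * (2 * n + 1) * catalan n := by
  have h1 := succ_mul_catalan_eq_centralBinom n
  have h2 := succ_mul_catalan_eq_centralBinom (n + 1)
  have h3 := Nat.succ_mul_centralBinom_succ n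
  rw [← h1, ← h2] at h3
  have h4 : (n + 1) * ((n + 2) * catalan (n + 1)) = (n + 1) * (2 * (2 * n + 1) * catalan n) := by
    linarith
  exact_mod_cast Nat.eq_of_mul_eq_mul_left (Nat.succ_pos n) h4

theorem catalan_pos (n : ℕ) : (0 : ℝ) < catalan n := by
  have h := succ_mul_catalan_eq_centralBinom n
  have h' := Nat.centralBinom_pos n
  rw [← h] at h'
  exact_mod_cast pos_of_mul_pos_right h' (Nat.zero_le _)

/-- The number of the common cherries of two iterates, among the first `n` leaves. -/
noncomputable def commonCherries (n : ℕ) (p : Iterate × Iterate) : ℝ :=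
  ∑ i ∈ Finset.range n, indic (Cherry · i) p.1 * indic (Cherry · i) p.2

open Classical in
theorem sum_commonCherries (n : ℕ) :
    ∑ p ∈ iterates n ×ˢ iterates n, commonCherries n p = n * (catalan (n - 1) : ℝ) ^ 2 := by
  simp only [commonCherries]
  rw [Finset.sum_comm]
  simp only [sum_sum_indic_mul, sum_indic]
  rw [Finset.sum_congr rfl fun i hi => ?_, Finset.sum_const, Finset.card_range, nsmul_eq_mul]
  have h := card_cherries (A := {i}) (Finset.singleton_subset_iff.2 hi)
  simp only [Finset.mem_singleton, forall_eq, Finset.card_singleton, Nat.succ_ne_self,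
    not_false_eq_true, if_true] at h
  rw [h]

open Classical in
-- Each diagonal pair `i = j` gives `S_{n-1}²`; an off-diagonal pair gives `S_{n-2}²`, or 0 if the
-- places are adjacent.
theorem sum_commonCherries_sq_le (n : ℕ) :
    ∑ p ∈ iterates n ×ˢ iterates n, commonCherries n p ^ 2 ≤
      n * (catalan (n - 1) : ℝ) ^ 2 + n ^ 2 * (catalan (n - 2) : ℝ) ^ 2 := by
  have e : ∀ p ∈ iterates n ×ˢ iterates n, commonCherries n p ^ 2 =
      ∑ i ∈ Finset.range n, ∑ j ∈ Finset.range n,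
        indic (fun J => Cherry J i ∧ Cherry J j) p.1 *
          indic (fun J => Cherry J i ∧ Cherry J j) p.2 := by
    intro p _
    rw [commonCherries, sq, Finset.sum_mul_sum]
    refine Finset.sum_congr rfl fun i _ => Finset.sum_congr rfl fun j _ => ?_
    rw [indic_and, indic_and]
    ring
  rw [Finset.sum_congr rfl e, Finset.sum_comm]
  simp only [Finset.sum_comm (s := iterates n ×ˢ iterates n), sum_sum_indic_mul, sum_indic]
  have hb : ∀ i ∈ Finset.range n, ∀ j ∈ Finset.range n,
      ((((iterates n).filter fun J => Cherry J i ∧ Cherry J j).card : ℕ) : ℝ) ^ 2 ≤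
        (if i = j then (catalan (n - 1) : ℝ) ^ 2 else 0) + (catalan (n - 2) : ℝ) ^ 2 := by
    intro i hi j hj
    have h := card_cherries (n := n) (A := {i, j}) (by
      intro x hx
      rcases Finset.mem_insert.1 hx with rfl | hx
      · exact hi
      · exact Finset.mem_singleton.1 hx ▸ hj)
    have h' : ((iterates n).filter fun J => Cherry J i ∧ Cherry J j) =
        (iterates n).filter fun J => ∀ k ∈ ({i, j} : Finset ℕ), Cherry J k := by
      ext J
      simp
    rw [h', h]
    split_ifs with h1 h2 h2
    · subst h2
      simp only [Finset.pair_eq_singleton, Finset.card_singleton]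
      nlinarith [sq_nonneg (catalan (n - 2) : ℝ)]
    · rw [Finset.card_pair h2, zero_add]
    · rw [Nat.cast_zero, zero_pow two_ne_zero]
      positivity
    · rw [Nat.cast_zero, zero_pow two_ne_zero]
      positivity
  refine (Finset.sum_le_sum fun i hi => Finset.sum_le_sum fun j hj => hb i hi j hj).trans
    (le_of_eq ?_)
  simp only [Finset.sum_add_distrib, Finset.sum_ite_eq, Finset.sum_const, Finset.card_range,
    nsmul_eq_mul]
  rw [Finset.sum_congr rfl fun i hi => if_pos hi, Finset.sum_const, Finset.card_range, nsmul_eq_mul]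
  ring

/-- The second moment method for the number of common cherries. -/
theorem card_irreducibleIdentities_mul_sq_le (n : ℕ) (hn : n ≠ 0) (m : ℝ) :
    ((irreducibleIdentities n).card : ℝ) * m ^ 2 ≤
      n * (catalan (n - 1) : ℝ) ^ 2 + n ^ 2 * (catalan (n - 2) : ℝ) ^ 2 -
        2 * m * (n * (catalan (n - 1) : ℝ) ^ 2) + m ^ 2 * (catalan n : ℝ) ^ 2 := by
  have h1 : ((irreducibleIdentities n).card : ℝ) * m ^ 2 =
      ∑ p ∈ irreducibleIdentities n, (commonCherries n p - m) ^ 2 := by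
    rw [← nsmul_eq_mul, ← Finset.sum_const]
    refine Finset.sum_congr rfl fun p hp => ?_
    simp only [irreducibleIdentities, Finset.mem_filter, Finset.mem_product,
      BinaryTree.mem_treesOfNumNodesEq] at hp
    obtain ⟨⟨hJ, hK⟩, hp⟩ := hp
    rw [formallyReducible_iff hn hJ hK] at hp
    have : commonCherries n p = 0 := by
      refine Finset.sum_eq_zero fun i hi => ?_
      have : ¬ (Cherry p.1 i ∧ Cherry p.2 i) := fun h =>
        hp (Or.inl ⟨i, Finset.mem_range.1 hi, h⟩)
      by_cases h1 : Cherry p.1 i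
      · have h2 : ¬ Cherry p.2 i := fun h2 => this ⟨h1, h2⟩
        simp [indic, h2]
      · simp [indic, h1]
    rw [this]
    ring
  have h2 : ∑ p ∈ irreducibleIdentities n, (commonCherries n p - m) ^ 2 ≤
      ∑ p ∈ iterates n ×ˢ iterates n, (commonCherries n p - m) ^ 2 :=
    Finset.sum_le_sum_of_subset_of_nonneg (Finset.filter_subset _ _) fun p _ _ => sq_nonneg _
  have h3 : ∑ p ∈ iterates n ×ˢ iterates n, (commonCherries n p - m) ^ 2 =
      ∑ p ∈ iterates n ×ˢ iterates n, commonCherries n p ^ 2 -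
        2 * m * ∑ p ∈ iterates n ×ˢ iterates n, commonCherries n p +
        m ^ 2 * (catalan n : ℝ) ^ 2 := by
    have hc : ∑ p ∈ iterates n ×ˢ iterates n, m ^ 2 = m ^ 2 * (catalan n : ℝ) ^ 2 := by
      rw [Finset.sum_const, Finset.card_product, BinaryTree.treesOfNumNodesEq_card_eq_catalan,
        nsmul_eq_mul]
      push_cast
      ring
    rw [← hc, Finset.mul_sum, ← Finset.sum_sub_distrib, ← Finset.sum_add_distrib]
    exact Finset.sum_congr rfl fun p _ => by ring
  have h4 := sum_commonCherries_sq_le n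
  rw [sum_commonCherries] at h3
  linarith

theorem card_irreducibleIdentities_le {n : ℕ} (hn : 4 ≤ n) :
    ((irreducibleIdentities n).card : ℝ) ≤ 32 * (1 / n * (catalan n : ℝ) ^ 2) := by
  obtain ⟨k, rfl⟩ : ∃ k, n = k + 2 := ⟨n - 2, by omega⟩
  have hk : (2 : ℝ) ≤ k := by exact_mod_cast (by omega : 2 ≤ k)
  have hs := catalan_pos k
  have ha := catalan_pos (k + 1)
  have hS := catalan_pos (k + 2)
  have r1 := catalan_succ_mul k
  have r2 := catalan_succ_mul (k + 1)
  -- `m` is the mean of `commonCherries` over all pairs, so the right side becomes `S_n²` times the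
  -- bound on the variance.
  have key := card_irreducibleIdentities_mul_sq_le (k + 2) (by omega)
    (((k + 2 : ℕ) : ℝ) * (catalan (k + 1) : ℝ) ^ 2 / (catalan (k + 2) : ℝ) ^ 2)
  rw [show k + 2 - 1 = k + 1 by omega, show k + 2 - 2 = k by omega] at key
  rw [show k + 1 + 1 = k + 2 by omega] at r2
  generalize (catalan k : ℝ) = s at *
  generalize (catalan (k + 1) : ℝ) = a at *
  generalize (catalan (k + 2) : ℝ) = S at *
  generalize ((irreducibleIdentities (k + 2)).card : ℝ) = I at *
  push_cast at *
  set N : ℝ := (k : ℝ) + 2 with hN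
  have hN4 : 4 ≤ N := by linarith
  have hk' : (k : ℝ) = N - 2 := by linarith
  rw [hk'] at r1 r2
  have hSa : S ≤ 4 * a := by nlinarith
  -- The ratio `s S / a²` is `1 + 3 / ((N + 1)(2N - 3))`, so the terms of order `N²` in the variance
  -- bound cancel up to a bounded error.
  have hsS : s * S * ((N + 1) * (2 * N - 3)) = N * (2 * N - 1) * a ^ 2 := by
    have : 2 * ((s * S) * ((N + 1) * (2 * N - 3))) = 2 * (N * (2 * N - 1) * a ^ 2) := by
      linear_combination (-(N + 1) * S) * r1 + N * a * r2
    linarith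
  have hsS' : N ^ 2 * (s * S) ≤ (N ^ 2 + 3) * a ^ 2 := by
    have hpos : 0 < (N + 1) * (2 * N - 3) := by nlinarith
    refine le_of_mul_le_mul_right ?_ hpos
    have : (N ^ 2 + 3) * a ^ 2 * ((N + 1) * (2 * N - 3)) - N ^ 2 * (N * (2 * N - 1) * a ^ 2) =
      3 * a ^ 2 * (N ^ 2 - N - 3) := by ring
    have h5 : 0 ≤ 3 * a ^ 2 * (N ^ 2 - N - 3) :=
      mul_nonneg (by positivity) (by nlinarith)
    linear_combination h5 + N ^ 2 * hsS
  have hsq : N ^ 2 * (s * S) ^ 2 ≤ (N ^ 2 + 16 * N) * a ^ 4 := by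
    have h6 : (N ^ 2 * (s * S)) ^ 2 ≤ ((N ^ 2 + 3) * a ^ 2) ^ 2 :=
      pow_le_pow_left₀ (by positivity) hsS' 2
    refine le_of_mul_le_mul_right ?_ (show 0 < N ^ 2 by positivity)
    have h7 : (N ^ 2 + 3) ^ 2 ≤ (N ^ 2 + 16 * N) * N ^ 2 := by nlinarith
    have h8 := mul_le_mul_of_nonneg_right h7 (show 0 ≤ a ^ 4 by positivity)
    nlinarith
  have key' : I * (N ^ 2 * a ^ 4) ≤ N * a ^ 2 * S ^ 4 + N ^ 2 * (s * S) ^ 2 * S ^ 2 -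
      N ^ 2 * a ^ 4 * S ^ 2 := by
    have h9 := mul_le_mul_of_nonneg_right key (show 0 ≤ S ^ 4 by positivity)
    have e1 : I * (N * a ^ 2 / S ^ 2) ^ 2 * S ^ 4 = I * (N ^ 2 * a ^ 4) := by
      field_simp
    have e2 : (N * a ^ 2 + N ^ 2 * s ^ 2 - 2 * (N * a ^ 2 / S ^ 2) * (N * a ^ 2) +
        (N * a ^ 2 / S ^ 2) ^ 2 * S ^ 2) * S ^ 4 =
        N * a ^ 2 * S ^ 4 + N ^ 2 * (s * S) ^ 2 * S ^ 2 - N ^ 2 * a ^ 4 * S ^ 2 := by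
      field_simp
      ring
    rwa [e1, e2] at h9
  have h10 : N * a ^ 2 * S ^ 4 ≤ 16 * N * a ^ 4 * S ^ 2 := by
    have : S ^ 2 ≤ (4 * a) ^ 2 := pow_le_pow_left₀ hS.le hSa 2
    have := mul_le_mul_of_nonneg_left this (show 0 ≤ N * a ^ 2 * S ^ 2 by positivity)
    linarith
  have h11 := mul_le_mul_of_nonneg_right hsq (show 0 ≤ S ^ 2 by positivity)
  -- The constant 32 is 16 from `S² ≤ 16 a²` on the diagonal plus the generous 16 in `hsq`.
  have h12 : I * (N ^ 2 * a ^ 4) ≤ 32 * (1 / N * S ^ 2) * (N ^ 2 * a ^ 4) := by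
    have : 32 * (1 / N * S ^ 2) * (N ^ 2 * a ^ 4) = 32 * N * a ^ 4 * S ^ 2 := by
      field_simp
    rw [this]
    linarith
  exact le_of_mul_le_mul_right h12 (by positivity)

/-! ### Asymptotic comparison -/

theorem tendsto_add_two_mul_exp :
    Tendsto (fun n : ℕ => ((n : ℝ) + 2) * Real.exp (-(n : ℝ) / 16)) atTop (nhds 0) := by
  have h1 := Real.tendsto_pow_mul_exp_neg_atTop_nhds_zero 1
  have h0 := Real.tendsto_pow_mul_exp_neg_atTop_nhds_zero 0
  have hd : Tendsto (fun n : ℕ => (n : ℝ) / 16) atTop atTop :=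
    tendsto_natCast_atTop_atTop.atTop_div_const (by norm_num)
  have := ((h1.comp hd).const_mul 16).add ((h0.comp hd).const_mul 2)
  simp only [mul_zero, add_zero] at this
  refine this.congr fun n => ?_
  simp only [Function.comp_apply, neg_div]
  ring

/-- Eventually `(n + 2) e^{-n/16} < 1`, so the term `2 / n` dominates. -/
theorem eventually_one_div_le_abs :
    ∀ᶠ n : ℕ in atTop,
      1 / (n : ℝ) ≤ |((n : ℝ) + 2) / n * Real.exp (-(n : ℝ) / 16) - 2 / n| := by
  filter_upwards [tendsto_add_two_mul_exp.eventually (gt_mem_nhds (zero_lt_one' ℝ)),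
    eventually_gt_atTop 0] with n hn h0
  have h0' : (0 : ℝ) < n := by exact_mod_cast h0
  rw [abs_sub_comm]
  refine le_trans ?_ (le_abs_self _)
  rw [div_mul_eq_mul_div, ← sub_div]
  gcongr
  linarith

theorem card_irreducibleIdentities_isBigO :
    (fun n : ℕ => ((irreducibleIdentities n).card : ℝ)) =O[atTop]
      fun n : ℕ => 1 / (n : ℝ) * (catalan n : ℝ) ^ 2 := by
  refine IsBigO.of_bound 32 ?_
  filter_upwards [eventually_ge_atTop 4] with n hn
  rw [Real.norm_of_nonneg (by positivity), Real.norm_of_nonneg (by positivity)]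
  exact card_irreducibleIdentities_le hn

theorem one_div_mul_catalan_sq_isBigO :
    (fun n : ℕ => 1 / (n : ℝ) * (catalan n : ℝ) ^ 2) =O[atTop]
      fun n : ℕ => |((n : ℝ) + 2) / n * Real.exp (-(n : ℝ) / 16) - 2 / n| * (catalan n : ℝ) ^ 2 := by
  refine IsBigO.of_bound 1 ?_
  filter_upwards [eventually_one_div_le_abs] with n hn
  rw [Real.norm_of_nonneg (by positivity), Real.norm_of_nonneg (by positivity), one_mul]
  gcongr

theorem ncard_irreducibleAlgebraClasses_le (n : ℕ) :
    (irreducibleAlgebraClasses.{u} n).ncard ≤ (irreducibleIdentities n).card := by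
  rw [irreducibleAlgebraClasses, ← Set.ncard_coe_finset (irreducibleIdentities n)]
  exact Set.ncard_image_le (Finset.finite_toSet _)

theorem card_reducibleIdentities_isEquivalent_catalan_sq :
    (fun n : ℕ => ((reducibleIdentities n).card : ℝ)) ~[atTop] fun n => (catalan n : ℝ) ^ 2 := by
  have h : (fun n : ℕ => 1 / (n : ℝ) * (catalan n : ℝ) ^ 2) =o[atTop]
      fun n => (catalan n : ℝ) ^ 2 := by
    have h1 : (fun n : ℕ => 1 / (n : ℝ)) =o[atTop] fun _ => (1 : ℝ) :=
      (isLittleO_one_iff ℝ).2 tendsto_one_div_atTop_nhds_zero_nat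
    simpa using h1.mul_isBigO (isBigO_refl (fun n : ℕ => (catalan n : ℝ) ^ 2) atTop)
  refine (card_irreducibleIdentities_isBigO.trans_isLittleO h).neg_left.congr_left fun n => ?_
  simp only [Pi.sub_apply, ← card_reducibleIdentities_add n]
  ring

theorem catalan_sq_isEquivalent :
    (fun n : ℕ => ((n : ℝ) + 2) / n * (catalan n : ℝ) ^ 2 * (1 - Real.exp (-(n : ℝ) / 16))) ~[atTop]
      fun n => (catalan n : ℝ) ^ 2 := by
  have h1 : Tendsto (fun n : ℕ => ((n : ℝ) + 2) / n * (1 - Real.exp (-(n : ℝ) / 16))) atTop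
      (nhds 1) := by
    have hi := tendsto_one_div_atTop_nhds_zero_nat (𝕜 := ℝ)
    have h := ((hi.const_mul 2).const_add 1).sub (tendsto_add_two_mul_exp.mul hi)
    simp only [mul_zero, add_zero, sub_zero] at h
    refine h.congr' ?_
    filter_upwards [eventually_gt_atTop 0] with n hn
    have : (n : ℝ) ≠ 0 := by exact_mod_cast hn.ne'
    field_simp
  have h2 : (fun n : ℕ => ((n : ℝ) + 2) / n * (1 - Real.exp (-(n : ℝ) / 16))) ~[atTop]
      fun _ => (1 : ℝ) := (isEquivalent_const_iff_tendsto one_ne_zero).2 h1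
  have h3 := h2.mul (IsEquivalent.refl (u := fun n : ℕ => (catalan n : ℝ) ^ 2) (l := atTop))
  convert h3 using 1
  · ext n
    simp only [Pi.mul_apply]
    ring
  · ext n
    simp

end MagmaIdentity

theorem mainTheorem1 :
    ((fun n : ℕ => ((MagmaIdentity.irreducibleIdentities n).card : ℝ)) =O[atTop]
      fun n : ℕ => |((n : ℝ) + 2) / n * Real.exp (-(n : ℝ) / 16) - 2 / n| * (catalan n : ℝ) ^ 2) ∧
    ((fun n : ℕ => ((MagmaIdentity.irreducibleAlgebraClasses.{u} n).ncard : ℝ)) =O[atTop]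
      fun n : ℕ => |((n : ℝ) + 2) / n * Real.exp (-(n : ℝ) / 16) - 2 / n| * (catalan n : ℝ) ^ 2) ∧
    (∀ n : ℕ, 2 ≤ n →
      ((MagmaIdentity.reducibleIdentities n).card : ℝ) =
        ((n : ℝ) + 2) * ∑ ν ∈ Finset.range (n / 2 + 1),
          (-1 : ℝ) ^ ν * (1 / ((ν : ℝ) + 1)) * ((n - ν).choose ν : ℝ) *
            (catalan (n - ν - 1) : ℝ) ^ 2) ∧
    ((fun n : ℕ => ((MagmaIdentity.reducibleIdentities n).card : ℝ)) ~[atTop]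
      fun n : ℕ => ((n : ℝ) + 2) / n * (catalan n : ℝ) ^ 2 * (1 - Real.exp (-(n : ℝ) / 16))) := by
  have h := MagmaIdentity.card_irreducibleIdentities_isBigO.trans
    MagmaIdentity.one_div_mul_catalan_sq_isBigO
  -- Distinct classes come from distinct identities, so part 2 follows from part 1.
  refine ⟨h, IsBigO.trans (IsBigO.of_norm_le fun n => ?_) h,
    fun n hn => MagmaIdentity.card_reducibleIdentities hn,
    MagmaIdentity.card_reducibleIdentities_isEquivalent_catalan_sq.trans
      MagmaIdentity.catalan_sq_isEquivalent.symm⟩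
  rw [Real.norm_of_nonneg (by positivity)]
  exact_mod_cast MagmaIdentity.ncard_irreducibleAlgebraClasses_le n
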